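/- Let $1\le k\le d$, let $\mathcal X\subset\mathbb R^d$ be compact, and let $\mathcal M$ be the set of Borel probability measures on $\mathcal X$. For $\mu\in\mathcal M$ let $E_\mu$ be its mean and $V_\mu$ its covariance matrix. For a $d\times d$ matrix $V$ put $\Psi_k(V)=\frac{k+1}{k!}\,\mathcal E_k(V)$, where $\mathcal E_k(V)$ is the sum of the $k\times k$ principal minors of $V$ (for symmetric $V$, the elementary symmetric function of degree $k$ of its eigenvalues), let $\nabla_{\Psi_k}[V]$ be the gradient of $\Psi_k$ at $V$, and, when $\Psi_k(V)>0$, put $M_*(V)=\nabla_{\Psi_k}[V]/(k\,\Psi_k(V))$. For symmetric $M\succeq0$ and $c\in\mathbb R^d$ let $\mathcal E(M,c)=\{x\in\mathbb R^d:(x-c)^\top M(x-c)\le 1\}$ and $$\phi_k^\infty(M)=\inf\{\Psi_k(V)^{-1/k}:\ V\succeq0,\ \operatorname{tr}(MV)=1\}\quad(M\neq 0,\ 1/0:=+\infty),\qquad \phi_k^\infty(0)=0 .$$ Assume that $\Psi_k(V_\mu)>0$ for some $\mu\in\mathcal M$ (equivalently, $\mathcal X$ is not contained in an affine subspace of dimension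 less than $k$). Call $\mu\in\mathcal M$ optimal if it maximises $\Psi_k(V_\mu)$ over $\mathcal M$; call $(M,c)$ with $M\succeq0$ and $\mathcal X\subset\mathcal E(M,c)$ optimal if $M$ maximises $\phi_k^\infty$ over all such pairs. Then the determination of an optimal covariance matrix and that of an optimal enclosing ellipsoid are equivalent, in the following sense. 1. Optimal measures and optimal pairs $(M,c)$ exist. 2. For $\mu\in\mathcal M$ and $M\succeq0$, $c\in\mathbb R^d$ with $\mathcal X\subset\mathcal E(M,c)$, the following are equivalent: (i) $\mu$ and $(M,c)$ are both optimal; (ii) $\Psi_k^{1/k}(V_\mu)\,\phi_k^\infty(M)=1$; (iii) $\operatorname{tr}(MV_\mu)=1$ and $V_\mu$ maximises $\Psi_k(V)$ over all $V\succeq0$ with $\operatorname{tr}(MV)=1$. 3. If $\mu_k^*$ is optimal, then $(M_*(V_{\mu_k^*}),E_{\mu_k^*})$ is optimal. 4. If $\mu_k^*$ and $(M_k^*,c_k^*)$ are optimal, then $M_k^*$ is positive definite, $c_k^*=E_{\mu_k^*}$, and every point of the support of $\mu_k^*$ is a point of contact between $\mathcal X$ and $\mathcal E(M_k^*,c_k^*)$,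 that is, it lies in $\mathcal X\cap\partial\mathcal E(M_k^*,c_k^*)$. -/

import Mathlib

open MeasureTheory ProbabilityTheory

noncomputable section

namespace GenVar

/-- The set of all probability measures on the Borel subsets of `X ⊆ ℝ^d`, viewed as Borel
probability measures on `ℝ^d` that give no mass to the complement of `X`. -/
def probMeasures {d : ℕ} (X : Set (Fin d → ℝ)) : Set (Measure (Fin d → ℝ)) :=
  {μ | IsProbabilityMeasure μ ∧ μ Xᶜ = 0}

/-- The mean `E_μ`. -/
def mean {d : ℕ} (μ : Measure (Fin d → ℝ)) : Fin d → ℝ :=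
  fun i => ∫ x, x i ∂μ

/-- The covariance matrix `V_μ`. -/
def covMat {d : ℕ} (μ : Measure (Fin d → ℝ)) : Matrix (Fin d) (Fin d) ℝ :=
  Matrix.of fun i j => cov[fun x => x i, fun x => x j; μ]

/-- `E_k(V)`, the sum of the `k × k` principal minors of `V`; for a symmetric `V` this is the
elementary symmetric function of degree `k` of the eigenvalues of `V`. -/
def elemSym {d : ℕ} (k : ℕ) (V : Matrix (Fin d) (Fin d) ℝ) : ℝ :=
  ∑ s ∈ (Finset.univ : Finset (Fin d)).powersetCard k,
    (V.submatrix (Subtype.val : s → Fin d) (Subtype.val : s → Fin d)).det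

/-- `Ψ_k(V) = (k+1)/k! · E_k(V)`. -/
def Psi {d : ℕ} (k : ℕ) (V : Matrix (Fin d) (Fin d) ℝ) : ℝ :=
  ((k : ℝ) + 1) / (k.factorial : ℝ) * elemSym k V

/-- The gradient of `Ψ_k` at `V`, i.e. the matrix of its partial derivatives
`∂Ψ_k/∂V_{ij}` (`Ψ_k` is a polynomial in the entries). -/
def gradPsi {d : ℕ} (k : ℕ) (V : Matrix (Fin d) (Fin d) ℝ) : Matrix (Fin d) (Fin d) ℝ :=
  Matrix.of fun i j => deriv (fun t : ℝ => Psi k (V + Matrix.single i j t)) 0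

/-- `M_*(V) = ∇Ψ_k[V] / (k Ψ_k(V))`, used only where `Ψ_k(V) > 0`. -/
def Mstar {d : ℕ} (k : ℕ) (V : Matrix (Fin d) (Fin d) ℝ) : Matrix (Fin d) (Fin d) ℝ :=
  ((k : ℝ) * Psi k V)⁻¹ • gradPsi k V

/-- The polar function `φ_k^∞(M) = inf {1 / Ψ_k(V)^{1/k} : V ⪰ 0, tr(MV) = 1}` for `M ⪰ 0`.
Matrices with `Ψ_k(V) = 0` contribute the value `+∞` to the infimum and are left out. For
`M ≠ 0` the set is non-empty (it contains the value at `V = I / tr M`) and bounded below by `0`;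
for `M = 0` no `V` is admissible and the value is `0`, the extension by homogeneity. -/
def polar {d : ℕ} (k : ℕ) (M : Matrix (Fin d) (Fin d) ℝ) : ℝ :=
  sInf {r : ℝ | ∃ V : Matrix (Fin d) (Fin d) ℝ,
    V.PosSemidef ∧ (M * V).trace = 1 ∧ 0 < Psi k V ∧ r = 1 / (Psi k V) ^ ((1 : ℝ) / k)}

/-- `E(M, c) = {x : (x - c)ᵀ M (x - c) ≤ 1}`. -/
def ellipsoid {d : ℕ} (M : Matrix (Fin d) (Fin d) ℝ) (c : Fin d → ℝ) : Set (Fin d → ℝ) :=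
  {x | (x - c) ⬝ᵥ (M.mulVec (x - c)) ≤ 1}

/-- `M ⪰ 0` and `X ⊆ E(M, c)`. -/
def Encloses {d : ℕ} (X : Set (Fin d → ℝ)) (M : Matrix (Fin d) (Fin d) ℝ) (c : Fin d → ℝ) :
    Prop :=
  M.PosSemidef ∧ X ⊆ ellipsoid M c

/-- `μ` maximises `Ψ_k(V_μ)` over the probability measures on `X`. -/
def IsOptimalMeasure {d : ℕ} (k : ℕ) (X : Set (Fin d → ℝ)) (μ : Measure (Fin d → ℝ)) : Prop :=
  μ ∈ probMeasures X ∧ ∀ ν ∈ probMeasures X, Psi k (covMat ν) ≤ Psi k (covMat μ)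

/-- `E(M, c)` contains `X` and `M` maximises `φ_k^∞` over all ellipsoids containing `X`. -/
def IsOptimalEllipsoid {d : ℕ} (k : ℕ) (X : Set (Fin d → ℝ)) (M : Matrix (Fin d) (Fin d) ℝ)
    (c : Fin d → ℝ) : Prop :=
  Encloses X M c ∧
    ∀ (M' : Matrix (Fin d) (Fin d) ℝ) (c' : Fin d → ℝ), Encloses X M' c' → polar k M' ≤ polar k M

/-- `V` maximises `Ψ_k` over the `W ⪰ 0` with `tr(MW) = 1`, i.e. `V` attains the infimum that
defines the polar function at `M`. -/
def AttainsPolar {d : ℕ} (k : ℕ) (M V : Matrix (Fin d) (Fin d) ℝ) : Prop :=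
  V.PosSemidef ∧ (M * V).trace = 1 ∧
    ∀ W : Matrix (Fin d) (Fin d) ℝ, W.PosSemidef → (M * W).trace = 1 → Psi k W ≤ Psi k V

/-- The points of contact between `X` and the ellipsoid `E(M, c)`. -/
def contactPoints {d : ℕ} (X : Set (Fin d → ℝ)) (M : Matrix (Fin d) (Fin d) ℝ)
    (c : Fin d → ℝ) : Set (Fin d → ℝ) :=
  X ∩ frontier (ellipsoid M c)

end GenVar

end

/-! The theorem is a duality without gap. If `X` lies in `E(M, c)`, integrating the quadratic form
of the ellipsoid against `μ` gives `tr(M V_μ)` plus the form at `E_μ`, in total at most 1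
(`trace_mul_covMat_add_le`). The definition of the polar function gives `φ(M) Ψ^{1/k}(V) ≤ tr(MV)`
(`polar_mul_rootPsi_le`). Hence `Ψ^{1/k}(V_μ) φ(M) ≤ 1` for every feasible pair, and equality
certifies optimality on both sides.

Equality is reached. A maximising `μ` exists by weak compactness. Moving mass from it towards `δ_x`
cannot increase `Ψ_k`, and this first-order condition says exactly that `X ⊆ E(M_*(V_μ), E_μ)`.
Since `Ψ_k^{1/k}` is concave, `V_μ` attains the polar function at `M_*(V_μ)`, so the product is 1.
For any optimal pair all the inequalities above are then equalities: this yields trace one, the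
centre and the contact points.

The deep input is superadditivity of `E_k^{1/k}` on the semidefinite cone. Up to sign `E_k` is a
coefficient of the characteristic polynomial, so Gauss–Lucas makes `t ↦ E_k(A + tB)` real-rooted for
`B` positive definite; AM-GM applied to its linear factors finishes. -/

namespace GenVar

open Polynomial Matrix

/-! ### Hyperbolicity of `E_k` and superadditivity of `E_k^{1/k}` -/

section Hyperbolic

variable {n : Type*} [Fintype n] [DecidableEq n]

/-- The sum of the `k × k` principal minors of a matrix over a commutative ring. -/
def minorSum {R : Type*} [CommRing R] (k : ℕ) (V : Matrix n n R) : R :=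
  ∑ s ∈ (Finset.univ : Finset n).powersetCard k,
    (V.submatrix (Subtype.val : s → n) (Subtype.val : s → n)).det

lemma minorSum_map {R S : Type*} [CommRing R] [CommRing S] (f : R →+* S) (k : ℕ)
    (V : Matrix n n R) : minorSum k (V.map f) = f (minorSum k V) := by
  simp only [minorSum, map_sum, RingHom.map_det, RingHom.mapMatrix_apply, submatrix_map]

/-- If all roots of a polynomial of degree at least `m` lie in the open upper half-plane, then so
do the roots of its `m`-th derivative. -/
lemma im_pos_of_iterate_derivative_root (m : ℕ) (P : ℂ[X]) (hm : m ≤ P.natDegree)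
    (hP : ∀ z, P.eval z = 0 → 0 < z.im) (z : ℂ) (hz : (derivative^[m] P).eval z = 0) :
    0 < z.im := by
  induction m generalizing P with
  | zero => exact hP z hz
  | succ m ih =>
    have hdeg : P.derivative.natDegree = P.natDegree - 1 := natDegree_derivative P
    have hpos : 0 < P.degree := natDegree_pos_iff_degree_pos.mp (by omega)
    have hne : P.derivative ≠ 0 := fun h => by
      have := derivative_eq_zero.mp h
      omega
    refine ih P.derivative (by omega) (fun w hw => ?_) hz
    have hw' : w ∈ P.derivative.rootSet ℂ := by
      rw [mem_rootSet, coe_aeval_eq_eval]; exact ⟨hne, hw⟩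
    -- Gauss–Lucas: a convex set containing all roots contains those of the derivative.
    have hconv : Convex ℝ {z : ℂ | 0 < z.im} := convex_halfSpace_im_gt 0
    refine convexHull_min (fun y hy => ?_) hconv
      (rootSet_derivative_subset_convexHull_rootSet hpos hw')
    rw [mem_rootSet, coe_aeval_eq_eval] at hy
    exact hP y hy.2

/-- Pairing `Zv = zv` with `v` gives `v* Z v = z |v|²`, and `|v|²` is real and nonnegative. -/
lemma charpoly_root_im_pos (Z : Matrix n n ℂ)
    (hZ : ∀ v : n → ℂ, v ≠ 0 → 0 < (star v ⬝ᵥ Z *ᵥ v).im) (z : ℂ)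
    (hz : Z.charpoly.eval z = 0) : 0 < z.im := by
  rw [eval_charpoly] at hz
  obtain ⟨v, hv, hv0⟩ := exists_mulVec_eq_zero_iff.mpr hz
  have h1 : Z *ᵥ v = z • v := by
    rw [sub_mulVec, sub_eq_zero] at hv0
    rw [← hv0]; ext i; simp [scalar_apply, mulVec_diagonal]
  have h2 := hZ v hv
  rw [h1, dotProduct_smul, smul_eq_mul] at h2
  have h3 : star v ⬝ᵥ v = ((∑ i, Complex.normSq (v i) : ℝ) : ℂ) := by
    simp [dotProduct, Complex.normSq_eq_conj_mul_self]
  rw [h3, Complex.im_mul_ofReal] at h2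
  exact pos_of_mul_pos_left h2 (Finset.sum_nonneg fun i _ => Complex.normSq_nonneg _)

/-- If `E_k(Z)` vanished, so would the coefficient of degree `n - k` of the characteristic
polynomial, and 0 would be a root of its `(n - k)`-th derivative, whose roots all have positive
imaginary part. -/
lemma minorSum_ne_zero (Z : Matrix n n ℂ)
    (hZ : ∀ v : n → ℂ, v ≠ 0 → 0 < (star v ⬝ᵥ Z *ᵥ v).im) (k : ℕ) (hk : k ≤ Fintype.card n) :
    minorSum k Z ≠ 0 := by
  intro h0
  have hc := charpoly_coeff_eq_sum_minors Z k hk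
  change _ = (-1) ^ k * minorSum k Z at hc
  rw [h0, mul_zero] at hc
  have hz : (derivative^[Fintype.card n - k] Z.charpoly).eval 0 = 0 := by
    rw [← coeff_zero_eq_eval_zero, coeff_iterate_derivative, zero_add, hc, smul_zero]
  have := im_pos_of_iterate_derivative_root _ _ (by simp)
    (charpoly_root_im_pos Z hZ) 0 hz
  simp at this

omit [DecidableEq n] in
lemma re_star_dotProduct_map_ofReal (B : Matrix n n ℝ) (v : n → ℂ) :
    (star v ⬝ᵥ (B.map (algebraMap ℝ ℂ)) *ᵥ v).re =
      (fun i => (v i).re) ⬝ᵥ B *ᵥ (fun i => (v i).re) +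
        (fun i => (v i).im) ⬝ᵥ B *ᵥ (fun i => (v i).im) := by
  simp [dotProduct, mulVec, Finset.mul_sum, ← Finset.sum_add_distrib]

lemma minorSum_add_smul_ne_zero {A B : Matrix n n ℝ} (hA : A.IsHermitian) (hB : B.PosDef)
    {k : ℕ} (hk : k ≤ Fintype.card n) {t : ℂ} (ht : 0 < t.im) :
    minorSum k (A.map (algebraMap ℝ ℂ) + t • B.map (algebraMap ℝ ℂ)) ≠ 0 := by
  refine minorSum_ne_zero _ (fun v hv => ?_) k hk
  have hmap : ∀ M : Matrix n n ℝ, M.IsHermitian → (M.map (algebraMap ℝ ℂ)).IsHermitian := by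
    intro M hM
    ext i j
    have := hM.apply i j
    simpa using this
  have hAi := (hmap A hA).im_star_dotProduct_mulVec_self v
  have hBi := (hmap B hB.1).im_star_dotProduct_mulVec_self v
  simp only [RCLike.im_to_complex] at hAi hBi
  rw [add_mulVec, smul_mulVec, dotProduct_add, dotProduct_smul, smul_eq_mul, Complex.add_im,
    Complex.mul_im, hAi, hBi, mul_zero, zero_add, zero_add, re_star_dotProduct_map_ofReal]
  refine mul_pos ht ?_
  have hnn : ∀ u : n → ℝ, 0 ≤ u ⬝ᵥ B *ᵥ u := fun u => by
    simpa using hB.posSemidef.dotProduct_mulVec_nonneg u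
  have hp : ∀ u : n → ℝ, u ≠ 0 → 0 < u ⬝ᵥ B *ᵥ u := fun u hu => by
    simpa using hB.dotProduct_mulVec_pos hu
  by_cases h : (fun i => (v i).re) = 0
  · refine add_pos_of_nonneg_of_pos (hnn _) (hp _ fun h' => hv ?_)
    ext i
    exact Complex.ext (congrFun h i) (congrFun h' i)
  · exact add_pos_of_pos_of_nonneg (hp _ h) (hnn _)

/-- The polynomial `t ↦ E_k(A + tB)`. -/
noncomputable def minorSumPoly (k : ℕ) (A B : Matrix n n ℝ) : ℝ[X] :=
  minorSum k ((X : ℝ[X]) • B.map C + A.map C)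

lemma eval_minorSumPoly (k : ℕ) (A B : Matrix n n ℝ) (t : ℝ) :
    (minorSumPoly k A B).eval t = minorSum k (A + t • B) := by
  rw [minorSumPoly, ← coe_evalRingHom, ← minorSum_map]
  congr 1
  ext i j
  simp [add_comm]
  exact mul_comm _ _

lemma aeval_minorSumPoly (k : ℕ) (A B : Matrix n n ℝ) (t : ℂ) :
    aeval t (minorSumPoly k A B) =
      minorSum k (A.map (algebraMap ℝ ℂ) + t • B.map (algebraMap ℝ ℂ)) := by
  have h := minorSum_map (aeval (R := ℝ) t).toRingHom k ((X : ℝ[X]) • B.map C + A.map C)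
  refine (Eq.trans ?_ h).symm
  congr 1
  ext i j
  simp [add_comm]
  exact mul_comm _ _

lemma natDegree_minorSumPoly_le (k : ℕ) (A B : Matrix n n ℝ) :
    (minorSumPoly k A B).natDegree ≤ k := by
  refine natDegree_sum_le_of_forall_le _ _ fun s hs => ?_
  have := natDegree_det_X_add_C_le (B.submatrix (Subtype.val : s → n) Subtype.val)
    (A.submatrix (Subtype.val : s → n) Subtype.val)
  rwa [Fintype.card_coe, (Finset.mem_powersetCard.mp hs).2] at this

lemma coeff_minorSumPoly (k : ℕ) (A B : Matrix n n ℝ) :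
    (minorSumPoly k A B).coeff k = minorSum k B := by
  rw [minorSumPoly, minorSum, finsetSum_coeff, minorSum]
  refine Finset.sum_congr rfl fun s hs => ?_
  have := coeff_det_X_add_C_card (B.submatrix (Subtype.val : s → n) Subtype.val)
    (A.submatrix (Subtype.val : s → n) Subtype.val)
  rwa [Fintype.card_coe, (Finset.mem_powersetCard.mp hs).2] at this

lemma minorSum_nonneg {A : Matrix n n ℝ} (hA : A.PosSemidef) (k : ℕ) : 0 ≤ minorSum k A :=
  Finset.sum_nonneg fun _ _ => (hA.submatrix _).det_nonneg

lemma minorSum_pos {A : Matrix n n ℝ} (hA : A.PosDef) {k : ℕ} (hk : k ≤ Fintype.card n) :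
    0 < minorSum k A := by
  refine Finset.sum_pos (fun s _ => (hA.submatrix Subtype.val_injective).det_pos) ?_
  rw [Finset.powersetCard_nonempty]
  simpa using hk

lemma splits_minorSumPoly {A B : Matrix n n ℝ} (hA : A.IsHermitian) (hB : B.PosDef)
    {k : ℕ} (hk : k ≤ Fintype.card n) : (minorSumPoly k A B).Splits := by
  have key : ∀ z : ℂ, aeval z (minorSumPoly k A B) = 0 → z.im = 0 := by
    intro z hz
    -- The coefficients are real, so roots are closed under conjugation and excluding the upper
    -- half-plane is enough.
    have hlow : ∀ w : ℂ, aeval w (minorSumPoly k A B) = 0 → w.im ≤ 0 := by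
      intro w hw
      by_contra! h
      exact minorSum_add_smul_ne_zero hA hB hk h (by rw [← aeval_minorSumPoly, hw])
    have h1 := hlow z hz
    have h2 := hlow (starRingEnd ℂ z) (by rw [aeval_conj, hz, map_zero])
    rw [Complex.conj_im] at h2
    linarith
  refine Splits.of_splits_map (algebraMap ℝ ℂ) (IsAlgClosed.splits _) fun z hz => ?_
  have hz' : aeval z (minorSumPoly k A B) = 0 := by
    rw [aeval_def, ← eval_map]
    exact isRoot_of_mem_roots hz
  exact ⟨z.re, Complex.ext (by simp) (by simp [key z hz'])⟩

/-- **Hyperbolicity** of `E_k` in positive definite directions. -/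
lemma exists_minorSum_add_smul_eq_prod {A B : Matrix n n ℝ} (hA : A.PosDef) (hB : B.PosDef)
    {k : ℕ} (hk : k ≤ Fintype.card n) :
    ∃ ρ : Fin k → ℝ, (∀ i, 0 < ρ i) ∧
      ∀ t : ℝ, minorSum k (A + t • B) = minorSum k B * ∏ i, (t + ρ i) := by
  have hpos := minorSum_pos hB hk
  have hdeg : (minorSumPoly k A B).natDegree = k :=
    le_antisymm (natDegree_minorSumPoly_le k A B)
      (le_natDegree_of_ne_zero (by rw [coeff_minorSumPoly]; exact hpos.ne'))
  have hlead : (minorSumPoly k A B).leadingCoeff = minorSum k B := by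
    rw [leadingCoeff, hdeg, coeff_minorSumPoly]
  have hspl := splits_minorSumPoly hA.1 hB hk
  have hcard := hspl.natDegree_eq_card_roots
  rw [hdeg] at hcard
  have hne : minorSumPoly k A B ≠ 0 := by
    rw [← leadingCoeff_ne_zero, hlead]; exact hpos.ne'
  obtain ⟨l, hl⟩ : ∃ l : List ℝ, (l : Multiset ℝ) = (minorSumPoly k A B).roots :=
    ⟨_, Multiset.coe_toList _⟩
  rw [← hl, Multiset.coe_card] at hcard
  subst hcard
  refine ⟨fun i => -l.get i, fun i => ?_, fun t => ?_⟩
  · have hmem : l.get i ∈ (minorSumPoly l.length A B).roots := by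
      rw [← hl]; exact List.get_mem _ _
    rw [mem_roots hne, IsRoot, eval_minorSumPoly] at hmem
    -- At a root `t ≥ 0` the matrix `A + tB` would still be positive definite.
    by_contra! h
    exact (minorSum_pos (hA.add_posSemidef (hB.posSemidef.smul (by linarith))) hk).ne' hmem
  · rw [← eval_minorSumPoly, hspl.eval_eq_prod_roots, hlead, ← hl]
    congr 1
    rw [Multiset.map_coe, Multiset.prod_coe, ← List.prod_ofFn]
    congr 1
    apply List.ext_get <;> simp [sub_eq_add_neg]

/-- AM-GM for `ρ i / (1 + ρ i)` and for `1 / (1 + ρ i)`: the two arithmetic means add up to 1. -/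
lemma prod_rpow_inv_card_add_le {k : ℕ} (hk : 1 ≤ k) (ρ : Fin k → ℝ) (hρ : ∀ i, 0 < ρ i) :
    1 + (∏ i, ρ i) ^ ((1 : ℝ) / k) ≤ (∏ i, (1 + ρ i)) ^ ((1 : ℝ) / k) := by
  have hk0 : (k : ℝ) ≠ 0 := by positivity
  have hw : ∑ _i : Fin k, (1 : ℝ) / k = 1 := by simp [hk0]
  have hpos : ∀ i, 0 < 1 + ρ i := fun i => by linarith [hρ i]
  have amgm : ∀ z : Fin k → ℝ, (∀ i, 0 ≤ z i) →
      (∏ i, z i) ^ ((1 : ℝ) / k) ≤ ∑ i, (1 : ℝ) / k * z i := fun z hz => by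
    rw [← Real.finsetProd_rpow _ _ (fun i _ => hz i)]
    exact Real.geom_mean_le_arith_mean_weighted _ _ _ (fun i _ => by positivity) hw
      (fun i _ => hz i)
  have h1 := amgm (fun i => ρ i / (1 + ρ i)) fun i => (div_pos (hρ i) (hpos i)).le
  have h2 := amgm (fun i => 1 / (1 + ρ i)) fun i => (div_pos one_pos (hpos i)).le
  have hsum : ∑ i, (1 : ℝ) / k * (ρ i / (1 + ρ i)) + ∑ i, (1 : ℝ) / k * (1 / (1 + ρ i)) = 1 := by
    rw [← Finset.sum_add_distrib]
    refine (Finset.sum_congr rfl fun i _ => ?_).trans hw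
    have := (hpos i).ne'
    field_simp
    ring
  have hP : 0 < ∏ i, (1 + ρ i) := Finset.prod_pos fun i _ => hpos i
  have hQ : 0 ≤ ∏ i, ρ i := Finset.prod_nonneg fun i _ => (hρ i).le
  rw [Finset.prod_div_distrib, Real.div_rpow hQ hP.le] at h1
  rw [Finset.prod_div_distrib, Finset.prod_const_one, Real.div_rpow zero_le_one hP.le,
    Real.one_rpow] at h2
  have hR : 0 < (∏ i, (1 + ρ i)) ^ ((1 : ℝ) / k) := Real.rpow_pos_of_pos hP _
  have h3 : (1 + (∏ i, ρ i) ^ ((1 : ℝ) / k)) / (∏ i, (1 + ρ i)) ^ ((1 : ℝ) / k) ≤ 1 := by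
    rw [add_div]; linarith
  exact (div_le_one hR).mp h3

lemma minorSum_rpow_add_le_of_posDef {A B : Matrix n n ℝ} (hA : A.PosDef) (hB : B.PosDef)
    {k : ℕ} (hk : k ≤ Fintype.card n) (hk1 : 1 ≤ k) :
    minorSum k A ^ ((1 : ℝ) / k) + minorSum k B ^ ((1 : ℝ) / k) ≤
      minorSum k (A + B) ^ ((1 : ℝ) / k) := by
  obtain ⟨ρ, hρ, h⟩ := exists_minorSum_add_smul_eq_prod hA hB hk
  have h0 := h 0
  have h1 := h 1
  simp only [zero_smul, add_zero, zero_add, one_smul] at h0 h1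
  have hb := minorSum_nonneg hB.posSemidef k
  rw [h0, h1, Real.mul_rpow hb (Finset.prod_nonneg fun i _ => (hρ i).le),
    Real.mul_rpow hb (Finset.prod_nonneg fun i _ => by linarith [hρ i])]
  have := mul_le_mul_of_nonneg_left (prod_rpow_inv_card_add_le hk1 ρ hρ)
    (Real.rpow_nonneg hb ((1 : ℝ) / k))
  linarith

lemma continuous_minorSum (k : ℕ) : Continuous fun A : Matrix n n ℝ => minorSum k A :=
  continuous_finsetSum _ fun _ _ => (continuous_id.matrix_submatrix _ _).matrix_det

/-- `E_k^{1/k}` is superadditive on the positive semidefinite cone. -/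
lemma minorSum_rpow_add_le {A B : Matrix n n ℝ} (hA : A.PosSemidef) (hB : B.PosSemidef)
    {k : ℕ} (hk : k ≤ Fintype.card n) (hk1 : 1 ≤ k) :
    minorSum k A ^ ((1 : ℝ) / k) + minorSum k B ^ ((1 : ℝ) / k) ≤
      minorSum k (A + B) ^ ((1 : ℝ) / k) := by
  have hcont : ∀ M : Matrix n n ℝ, Filter.Tendsto
      (fun ε : ℝ => minorSum k (M + ε • (1 : Matrix n n ℝ)) ^ ((1 : ℝ) / k))
      (nhdsWithin 0 (Set.Ioi 0)) (nhds (minorSum k M ^ ((1 : ℝ) / k))) := by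
    intro M
    have hc : Continuous fun ε : ℝ =>
        minorSum k (M + ε • (1 : Matrix n n ℝ)) ^ ((1 : ℝ) / k) :=
      ((continuous_minorSum k).comp (by fun_prop)).rpow_const fun _ => Or.inr (by positivity)
    simpa using (hc.tendsto 0).mono_left nhdsWithin_le_nhds
  have hAB : Filter.Tendsto
      (fun ε : ℝ => minorSum k (A + B + (2 * ε) • (1 : Matrix n n ℝ)) ^ ((1 : ℝ) / k))
      (nhdsWithin 0 (Set.Ioi 0)) (nhds (minorSum k (A + B) ^ ((1 : ℝ) / k))) := by
    have hc : Continuous fun ε : ℝ =>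
        minorSum k (A + B + (2 * ε) • (1 : Matrix n n ℝ)) ^ ((1 : ℝ) / k) :=
      ((continuous_minorSum k).comp (by fun_prop)).rpow_const fun _ => Or.inr (by positivity)
    simpa using (hc.tendsto 0).mono_left nhdsWithin_le_nhds
  refine le_of_tendsto_of_tendsto ((hcont A).add (hcont B)) hAB ?_
  filter_upwards [self_mem_nhdsWithin] with ε hε
  have hI : (ε • (1 : Matrix n n ℝ)).PosDef := Matrix.PosDef.one.smul hε
  have := minorSum_rpow_add_le_of_posDef (hI.posSemidef_add hA) (hI.posSemidef_add hB) hk hk1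
  rwa [add_add_add_comm, ← add_smul, ← two_mul] at this

end Hyperbolic

end GenVar

namespace GenVar

open Matrix

/-! ### Homogeneity, the polar function and weak duality -/

section Polar

variable {d : ℕ}

lemma Psi_eq_minorSum (k : ℕ) (V : Matrix (Fin d) (Fin d) ℝ) :
    Psi k V = ((k : ℝ) + 1) / (k.factorial : ℝ) * minorSum k V := rfl

lemma continuous_Psi (k : ℕ) : Continuous fun V : Matrix (Fin d) (Fin d) ℝ => Psi k V := by
  simp_rw [Psi_eq_minorSum]
  exact continuous_const.mul (continuous_minorSum k)

lemma Psi_nonneg {V : Matrix (Fin d) (Fin d) ℝ} (hV : V.PosSemidef) (k : ℕ) : 0 ≤ Psi k V :=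
  mul_nonneg (by positivity) (minorSum_nonneg hV k)

lemma Psi_pos {V : Matrix (Fin d) (Fin d) ℝ} (hV : V.PosDef) {k : ℕ} (hk : k ≤ d) :
    0 < Psi k V :=
  mul_pos (by positivity) (minorSum_pos hV (by simpa using hk))

lemma Psi_smul (k : ℕ) (c : ℝ) (V : Matrix (Fin d) (Fin d) ℝ) :
    Psi k (c • V) = c ^ k * Psi k V := by
  have h : minorSum k (c • V) = c ^ k * minorSum k V := by
    rw [minorSum, minorSum, Finset.mul_sum]
    refine Finset.sum_congr rfl fun s hs => ?_
    rw [show (c • V).submatrix (Subtype.val : s → Fin d) Subtype.val =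
      c • V.submatrix (Subtype.val : s → Fin d) Subtype.val from rfl, det_smul, Fintype.card_coe,
      (Finset.mem_powersetCard.mp hs).2]
  rw [Psi_eq_minorSum, Psi_eq_minorSum, h]
  ring

lemma Psi_transpose (k : ℕ) (V : Matrix (Fin d) (Fin d) ℝ) : Psi k Vᵀ = Psi k V := by
  rw [Psi_eq_minorSum, Psi_eq_minorSum, minorSum, minorSum]
  congr 1
  refine Finset.sum_congr rfl fun s _ => ?_
  rw [← transpose_submatrix, det_transpose]

/-- `Ψ_k^{1/k}`. -/
noncomputable def rootPsi (k : ℕ) (V : Matrix (Fin d) (Fin d) ℝ) : ℝ := Psi k V ^ ((1 : ℝ) / k)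

lemma rootPsi_nonneg {V : Matrix (Fin d) (Fin d) ℝ} (hV : V.PosSemidef) (k : ℕ) :
    0 ≤ rootPsi k V :=
  Real.rpow_nonneg (Psi_nonneg hV k) _

lemma rootPsi_pos {V : Matrix (Fin d) (Fin d) ℝ} {k : ℕ} (hV : 0 < Psi k V) : 0 < rootPsi k V :=
  Real.rpow_pos_of_pos hV _

lemma rootPsi_pow {V : Matrix (Fin d) (Fin d) ℝ} (hV : V.PosSemidef) {k : ℕ} (hk : 1 ≤ k) :
    rootPsi k V ^ k = Psi k V := by
  rw [rootPsi, one_div, Real.rpow_inv_natCast_pow (Psi_nonneg hV k) (by omega)]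

lemma rootPsi_smul {V : Matrix (Fin d) (Fin d) ℝ} (hV : V.PosSemidef) {k : ℕ} (hk : 1 ≤ k)
    {c : ℝ} (hc : 0 ≤ c) : rootPsi k (c • V) = c * rootPsi k V := by
  rw [rootPsi, Psi_smul, Real.mul_rpow (pow_nonneg hc k) (Psi_nonneg hV k), one_div,
    Real.pow_rpow_inv_natCast hc (by omega), rootPsi, one_div]

lemma rootPsi_le_rootPsi {V W : Matrix (Fin d) (Fin d) ℝ} (hV : V.PosSemidef) {k : ℕ}
    (h : Psi k V ≤ Psi k W) : rootPsi k V ≤ rootPsi k W :=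
  Real.rpow_le_rpow (Psi_nonneg hV k) h (by positivity)

lemma Psi_le_Psi_of_rootPsi_le {V W : Matrix (Fin d) (Fin d) ℝ} (hV : V.PosSemidef)
    (hW : W.PosSemidef) {k : ℕ} (hk : 1 ≤ k) (h : rootPsi k V ≤ rootPsi k W) :
    Psi k V ≤ Psi k W := by
  rw [← rootPsi_pow hV hk, ← rootPsi_pow hW hk]
  exact pow_le_pow_left₀ (rootPsi_nonneg hV k) h k

/-- `Ψ_k^{1/k}` is superadditive on the positive semidefinite cone. -/
lemma rootPsi_add_le {V W : Matrix (Fin d) (Fin d) ℝ} (hV : V.PosSemidef) (hW : W.PosSemidef)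
    {k : ℕ} (hk : 1 ≤ k) (hkd : k ≤ d) :
    rootPsi k V + rootPsi k W ≤ rootPsi k (V + W) := by
  have hc : (0 : ℝ) ≤ ((k : ℝ) + 1) / (k.factorial : ℝ) := by positivity
  simp only [rootPsi, Psi_eq_minorSum]
  rw [Real.mul_rpow hc (minorSum_nonneg hV k), Real.mul_rpow hc (minorSum_nonneg hW k),
    Real.mul_rpow hc (minorSum_nonneg (hV.add hW) k), ← mul_add]
  exact mul_le_mul_of_nonneg_left (minorSum_rpow_add_le hV hW (by simpa using hkd) hk)
    (Real.rpow_nonneg hc _)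

lemma rootPsi_le_add {V W : Matrix (Fin d) (Fin d) ℝ} (hV : V.PosSemidef) (hW : W.PosSemidef)
    {k : ℕ} (hk : 1 ≤ k) (hkd : k ≤ d) : rootPsi k V ≤ rootPsi k (V + W) :=
  (le_add_of_nonneg_right (rootPsi_nonneg hW k)).trans (rootPsi_add_le hV hW hk hkd)

lemma bddBelow_polar_set (k : ℕ) (M : Matrix (Fin d) (Fin d) ℝ) :
    BddBelow {r : ℝ | ∃ V : Matrix (Fin d) (Fin d) ℝ,
      V.PosSemidef ∧ (M * V).trace = 1 ∧ 0 < Psi k V ∧ r = 1 / (Psi k V) ^ ((1 : ℝ) / k)} := by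
  refine ⟨0, ?_⟩
  rintro r ⟨V, -, -, hV, rfl⟩
  exact one_div_nonneg.mpr (rootPsi_pos hV).le

lemma polar_nonneg (k : ℕ) (M : Matrix (Fin d) (Fin d) ℝ) : 0 ≤ polar k M := by
  refine Real.sInf_nonneg ?_
  rintro r ⟨V, -, -, hV, rfl⟩
  exact one_div_nonneg.mpr (rootPsi_pos hV).le

lemma polar_zero (k : ℕ) : polar k (0 : Matrix (Fin d) (Fin d) ℝ) = 0 := by
  simp [polar]

lemma polar_le {k : ℕ} {M V : Matrix (Fin d) (Fin d) ℝ} (hV : V.PosSemidef)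
    (hMV : (M * V).trace = 1) (hpos : 0 < Psi k V) : polar k M ≤ 1 / rootPsi k V :=
  csInf_le (bddBelow_polar_set k M) ⟨V, hV, hMV, hpos, rfl⟩

/-- Dividing `V` by `tr(MV)` makes it admissible in the infimum, unless `Ψ_k(V) = 0`, where the left
side is zero. -/
lemma polar_mul_rootPsi_le_of_trace_pos {k : ℕ} (hk : 1 ≤ k) {M V : Matrix (Fin d) (Fin d) ℝ}
    (hV : V.PosSemidef) (hMV : 0 < (M * V).trace) :
    polar k M * rootPsi k V ≤ (M * V).trace := by
  rcases (Psi_nonneg hV k).eq_or_lt with h | h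
  · have : rootPsi k V = 0 := by
      rw [rootPsi, ← h, Real.zero_rpow (by positivity)]
    rw [this, mul_zero]
    exact hMV.le
  · have hinv : 0 < (M * V).trace⁻¹ := inv_pos.mpr hMV
    have := polar_le (k := k) (M := M) (hV.smul hinv.le)
      (by rw [mul_smul_comm, trace_smul, smul_eq_mul, inv_mul_cancel₀ hMV.ne'])
      (by rw [Psi_smul]; positivity)
    rw [rootPsi_smul hV hk hinv.le] at this
    have hr := rootPsi_pos h
    rw [← le_div_iff₀ hr]
    refine this.trans_eq ?_
    field_simp

lemma trace_mul_nonneg {M V : Matrix (Fin d) (Fin d) ℝ} (hM : M.PosSemidef)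
    (hV : V.PosSemidef) : 0 ≤ (M * V).trace := by
  obtain ⟨m, u, rfl⟩ := Matrix.posSemidef_iff_eq_sum_vecMulVec.mp hV
  rw [Finset.mul_sum, trace_sum]
  refine Finset.sum_nonneg fun i _ => ?_
  rw [mul_vecMulVec, trace_vecMulVec, dotProduct_comm]
  exact hM.dotProduct_mulVec_nonneg _

/-- Weak duality between `Ψ_k^{1/k}` and its polar function. -/
lemma polar_mul_rootPsi_le {k : ℕ} (hk : 1 ≤ k) (hkd : k ≤ d) {M V : Matrix (Fin d) (Fin d) ℝ}
    (hM : M.PosSemidef) (hV : V.PosSemidef) :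
    polar k M * rootPsi k V ≤ (M * V).trace := by
  by_cases h0 : M = 0
  · simp [h0, polar_zero]
  have htr : 0 < M.trace :=
    hM.trace_nonneg.lt_of_ne fun h => h0 (hM.trace_eq_zero_iff.mp h.symm)
  -- `tr(MV)` may be zero, so `V` is replaced by `V + εI`, whose trace against `M` is positive
  -- because `tr M > 0`.
  have hlim : Filter.Tendsto (fun ε : ℝ => (M * V).trace + ε * M.trace)
      (nhdsWithin 0 (Set.Ioi 0)) (nhds ((M * V).trace)) := by
    have hc : Continuous fun ε : ℝ => (M * V).trace + ε * M.trace := by fun_prop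
    simpa using (hc.tendsto 0).mono_left nhdsWithin_le_nhds
  refine ge_of_tendsto hlim ?_
  filter_upwards [self_mem_nhdsWithin] with ε hε
  have hε' : (0 : ℝ) < ε := hε
  have hI : (ε • (1 : Matrix (Fin d) (Fin d) ℝ)).PosSemidef := Matrix.PosSemidef.one.smul hε'.le
  have heq : (M * (V + ε • (1 : Matrix (Fin d) (Fin d) ℝ))).trace =
      (M * V).trace + ε * M.trace := by
    rw [mul_add, mul_smul_comm, mul_one, trace_add, trace_smul, smul_eq_mul]
  have := polar_mul_rootPsi_le_of_trace_pos hk (M := M) (hV.add hI)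
    (by rw [heq]; exact add_pos_of_nonneg_of_pos (trace_mul_nonneg hM hV) (mul_pos hε' htr))
  rw [heq] at this
  exact (mul_le_mul_of_nonneg_left (rootPsi_le_add hV hI hk hkd) (polar_nonneg k M)).trans this

/-- The competitor `I / tr M` has positive `Ψ_k`. -/
lemma AttainsPolar.Psi_pos {k : ℕ} (hkd : k ≤ d) {M V : Matrix (Fin d) (Fin d) ℝ}
    (hM : M.PosSemidef) (h : AttainsPolar k M V) : 0 < Psi k V := by
  have h0 : M ≠ 0 := by
    rintro rfl
    simpa using h.2.1
  have htr : 0 < M.trace :=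
    hM.trace_nonneg.lt_of_ne fun h => h0 (hM.trace_eq_zero_iff.mp h.symm)
  have hI : (M.trace⁻¹ • (1 : Matrix (Fin d) (Fin d) ℝ)).PosDef :=
    Matrix.PosDef.one.smul (inv_pos.mpr htr)
  refine (GenVar.Psi_pos hI hkd).trans_le (h.2.2 _ hI.posSemidef ?_)
  rw [mul_smul_comm, mul_one, trace_smul, smul_eq_mul, inv_mul_cancel₀ htr.ne']

lemma AttainsPolar.rootPsi_mul_polar {k : ℕ} (hkd : k ≤ d)
    {M V : Matrix (Fin d) (Fin d) ℝ} (hM : M.PosSemidef) (h : AttainsPolar k M V) :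
    rootPsi k V * polar k M = 1 := by
  have hpos := h.Psi_pos hkd hM
  have heq : polar k M = 1 / rootPsi k V := by
    refine IsLeast.csInf_eq ⟨⟨V, h.1, h.2.1, hpos, rfl⟩, ?_⟩
    rintro r ⟨W, hW, hMW, hWpos, rfl⟩
    exact one_div_le_one_div_of_le (rootPsi_pos hWpos) (rootPsi_le_rootPsi hW (h.2.2 W hW hMW))
  rw [heq, mul_one_div_cancel (rootPsi_pos hpos).ne']

/-- The polar function vanishes at singular matrices. -/
lemma posDef_of_polar_pos {k : ℕ} (hk : 1 ≤ k) (hkd : k ≤ d) {M : Matrix (Fin d) (Fin d) ℝ}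
    (hM : M.PosSemidef) (hpos : 0 < polar k M) : M.PosDef := by
  refine Matrix.PosDef.of_dotProduct_mulVec_pos hM.1 fun {u} hu => ?_
  refine (hM.dotProduct_mulVec_nonneg u).lt_of_ne fun h0 => ?_
  rw [star_trivial] at h0
  obtain ⟨i, hi⟩ : ∃ i, u i ≠ 0 := by
    by_contra! h
    exact hu (funext h)
  obtain ⟨s, his, hs⟩ : ∃ s : Finset (Fin d), i ∈ s ∧ s.card = k := by
    obtain ⟨s, h1, -, h2⟩ := Finset.exists_subsuperset_card_eq (Finset.subset_univ {i})
      (by simpa using hk) (by simpa using hkd)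
    exact ⟨s, by simpa using h1, h2⟩
  have hvv : (vecMulVec u u).PosSemidef := by
    simpa using Matrix.posSemidef_vecMulVec_self_star u
  -- Along `I + t uuᵀ` the trace against `M` stays `tr M`, as `uᵀMu = 0`, while the minor on `s`
  -- grows linearly in `t`; weak duality bounds it.
  have hbound : ∀ t : ℝ, 0 ≤ t →
      ((k : ℝ) + 1) / (k.factorial : ℝ) * (1 + t * (u i) ^ 2) ≤ (M.trace / polar k M) ^ k := by
    intro t ht
    have hP : ((1 : Matrix (Fin d) (Fin d) ℝ) + t • vecMulVec u u).PosSemidef :=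
      Matrix.PosSemidef.one.add (hvv.smul ht)
    have h1 := polar_mul_rootPsi_le hk hkd hM hP
    rw [mul_add, mul_one, mul_smul_comm, trace_add, trace_smul, mul_vecMulVec, trace_vecMulVec,
      dotProduct_comm, ← h0, smul_zero, add_zero, mul_comm, ← le_div_iff₀ hpos] at h1
    refine le_trans ?_ (pow_le_pow_left₀ (rootPsi_nonneg hP k) h1 k)
    rw [rootPsi_pow hP hk, Psi_eq_minorSum]
    refine mul_le_mul_of_nonneg_left ?_ (by positivity)
    refine le_trans ?_ (Finset.single_le_sum
      (fun (s : Finset (Fin d)) _ => (hP.submatrix (Subtype.val : s → Fin d)).det_nonneg)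
      (Finset.mem_powersetCard.mpr ⟨Finset.subset_univ s, hs⟩))
    have h2 : ((1 : Matrix (Fin d) (Fin d) ℝ) + t • vecMulVec u u).submatrix
        (Subtype.val : s → Fin d) Subtype.val =
        1 + replicateCol Unit (fun j : s => t * u j) * replicateRow Unit (fun j : s => u j) := by
      ext a b
      simp only [submatrix_apply, Matrix.add_apply, Matrix.smul_apply, vecMulVec_apply,
        Matrix.mul_apply, replicateCol_apply, replicateRow_apply, Finset.univ_unique,
        Finset.sum_singleton, smul_eq_mul, mul_assoc, Matrix.one_apply, SetLike.coe_eq_coe]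
    rw [h2, det_one_add_replicateCol_mul_replicateRow]
    have h3 := Finset.single_le_sum (s := Finset.univ) (f := fun j : (s : Finset (Fin d)) => u j * (t * u j))
      (fun j _ => by nlinarith [mul_self_nonneg (u j)]) (Finset.mem_univ ⟨i, his⟩)
    simp only [dotProduct]
    nlinarith [h3]
  have hc : (0 : ℝ) < ((k : ℝ) + 1) / (k.factorial : ℝ) := by positivity
  have hu2 : 0 < (u i) ^ 2 := by positivity
  have hR : 0 ≤ (M.trace / polar k M) ^ k := pow_nonneg (div_nonneg hM.trace_nonneg hpos.le) k
  set R := (M.trace / polar k M) ^ k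
  set c := ((k : ℝ) + 1) / (k.factorial : ℝ)
  -- This `t` turns the bound into `c + R ≤ R`.
  have := hbound (R / (c * (u i) ^ 2)) (by positivity)
  have h4 : c * (1 + R / (c * (u i) ^ 2) * (u i) ^ 2) = c + R := by
    field_simp
  linarith

end Polar

end GenVar

namespace GenVar

open Matrix

/-! ### The gradient of `Ψ_k` and the matrix `M_*` -/

section Gradient

variable {d : ℕ}

lemma differentiable_Psi (k : ℕ) :
    Differentiable ℝ fun v : Fin d → Fin d → ℝ => Psi k (Matrix.of v) := by
  simp only [Psi, elemSym, det_apply, submatrix_apply, of_apply]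
  fun_prop

/-- The derivative of `Ψ_k` at `V` in the direction `W`. -/
noncomputable def dirPsi (k : ℕ) (V W : Matrix (Fin d) (Fin d) ℝ) : ℝ :=
  ∑ i, ∑ j, gradPsi k V i j * W i j

lemma hasDerivAt_Psi (k : ℕ) (V W : Matrix (Fin d) (Fin d) ℝ) :
    HasDerivAt (fun t : ℝ => Psi k (V + t • W)) (dirPsi k V W) 0 := by
  set F : (Fin d → Fin d → ℝ) → ℝ := fun v => Psi k (Matrix.of v) with hF
  set L := fderiv ℝ F (fun i j => V i j)
  have key : ∀ U : Matrix (Fin d) (Fin d) ℝ,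
      HasDerivAt (fun t : ℝ => Psi k (V + t • U)) (L fun i j => U i j) 0 := by
    intro U
    have hline : HasDerivAt (fun t : ℝ => ((fun i j => V i j + t * U i j) : Fin d → Fin d → ℝ))
        (fun i j => U i j) 0 := by
      rw [hasDerivAt_pi]
      intro i
      rw [hasDerivAt_pi]
      intro j
      simpa using ((hasDerivAt_id (0 : ℝ)).mul_const (U i j)).const_add (V i j)
    have hFd : HasFDerivAt F L ((fun t : ℝ => ((fun i j => V i j + t * U i j) :
        Fin d → Fin d → ℝ)) 0) := by
      simpa using (differentiable_Psi k (fun i j => V i j)).hasFDerivAt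
    exact hFd.comp_hasDerivAt 0 hline
  have hgrad : ∀ i j, gradPsi k V i j = L fun a b => Matrix.single i j (1 : ℝ) a b := by
    intro i j
    rw [gradPsi, of_apply, ← (key (Matrix.single i j 1)).deriv]
    simp [smul_single]
  have hsum : dirPsi k V W = L fun i j => W i j := by
    simp only [dirPsi, hgrad]
    have : (fun i j => W i j) =
        ∑ i, ∑ j, W i j • (fun a b => Matrix.single i j (1 : ℝ) a b) := by
      ext a b
      simp [Finset.sum_apply, Matrix.single_apply, ite_and]
    rw [this, map_sum]
    refine Finset.sum_congr rfl fun i _ => ?_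
    rw [map_sum]
    refine Finset.sum_congr rfl fun j _ => ?_
    rw [map_smul, smul_eq_mul, mul_comm]
  rw [hsum]
  exact key W

lemma le_of_hasDerivAt_of_le {f g : ℝ → ℝ} {f' g' : ℝ} (hf : HasDerivAt f f' 0)
    (hg : HasDerivAt g g' 0) (h0 : f 0 = g 0) (h : ∀ t, 0 < t → t < 1 → f t ≤ g t) : f' ≤ g' := by
  have h1 := (hg.sub hf).hasDerivWithinAt (s := Set.Ioi 0)
  rw [hasDerivWithinAt_iff_tendsto_slope' (by simp)] at h1
  have : 0 ≤ g' - f' := by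
    refine ge_of_tendsto h1 ?_
    filter_upwards [Ioo_mem_nhdsGT (zero_lt_one' ℝ)] with t ht
    rw [slope_def_field]
    simp only [Pi.sub_apply, h0, sub_self, sub_zero]
    exact div_nonneg (sub_nonneg.mpr (h t ht.1 ht.2)) ht.1.le
  linarith

/-- Euler's identity for a homogeneous polynomial of degree `k`. -/
lemma dirPsi_self (k : ℕ) (V : Matrix (Fin d) (Fin d) ℝ) : dirPsi k V V = k * Psi k V := by
  have h1 := hasDerivAt_Psi k V V
  have h2 : HasDerivAt (fun t : ℝ => (1 + t) ^ k * Psi k V) (k * Psi k V) 0 := by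
    simpa using (((hasDerivAt_id (0 : ℝ)).const_add 1).pow k).mul_const (Psi k V)
  refine h1.unique (h2.congr_of_eventuallyEq (Filter.Eventually.of_forall fun t => ?_))
  simp only
  rw [← Psi_smul, add_smul, one_smul]

/-- The supporting hyperplane inequality for the concave function `Ψ_k^{1/k}`. -/
lemma le_dirPsi {k : ℕ} (hk : 1 ≤ k) (hkd : k ≤ d) {V W : Matrix (Fin d) (Fin d) ℝ}
    (hV : V.PosSemidef) (hW : W.PosSemidef) :
    k * rootPsi k V ^ (k - 1) * rootPsi k W ≤ dirPsi k V W := by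
  -- Superadditivity is differentiated after raising to the power `k`, which avoids the root being
  -- non-smooth where `Ψ_k(V) = 0`.
  have h1 : HasDerivAt (fun t : ℝ => (rootPsi k V + t * rootPsi k W) ^ k)
      (k * rootPsi k V ^ (k - 1) * rootPsi k W) 0 := by
    simpa using (((hasDerivAt_id (0 : ℝ)).mul_const (rootPsi k W)).const_add (rootPsi k V)).fun_pow k
  refine le_of_hasDerivAt_of_le h1 (hasDerivAt_Psi k V W) ?_ fun t ht _ => ?_
  · simp [rootPsi_pow hV hk]
  · have htW := hW.smul ht.le
    rw [← rootPsi_pow (hV.add htW) hk, ← rootPsi_smul hW hk ht.le]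
    exact pow_le_pow_left₀ (add_nonneg (rootPsi_nonneg hV k) (rootPsi_nonneg htW k))
      (rootPsi_add_le hV htW hk hkd) k

lemma dirPsi_nonneg {k : ℕ} (hk : 1 ≤ k) (hkd : k ≤ d) {V W : Matrix (Fin d) (Fin d) ℝ}
    (hV : V.PosSemidef) (hW : W.PosSemidef) : 0 ≤ dirPsi k V W :=
  le_trans (mul_nonneg (mul_nonneg k.cast_nonneg (pow_nonneg (rootPsi_nonneg hV k) _))
    (rootPsi_nonneg hW k)) (le_dirPsi hk hkd hV hW)

lemma gradPsi_symm (k : ℕ) {V : Matrix (Fin d) (Fin d) ℝ} (hV : V.IsHermitian) (i j : Fin d) :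
    gradPsi k V j i = gradPsi k V i j := by
  simp only [gradPsi, of_apply]
  congr 1
  ext t
  rw [← Psi_transpose, transpose_add, transpose_single]
  congr 2

lemma dotProduct_gradPsi_mulVec (k : ℕ) (V : Matrix (Fin d) (Fin d) ℝ) (u : Fin d → ℝ) :
    u ⬝ᵥ gradPsi k V *ᵥ u = dirPsi k V (vecMulVec u u) := by
  simp only [dotProduct, mulVec, dirPsi, Finset.mul_sum, vecMulVec_apply]
  exact Finset.sum_congr rfl fun i _ => Finset.sum_congr rfl fun j _ => by ring

lemma posSemidef_gradPsi {k : ℕ} (hk : 1 ≤ k) (hkd : k ≤ d) {V : Matrix (Fin d) (Fin d) ℝ}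
    (hV : V.PosSemidef) : (gradPsi k V).PosSemidef := by
  refine Matrix.PosSemidef.of_dotProduct_mulVec_nonneg ?_ fun u => ?_
  · ext i j
    simpa using gradPsi_symm k hV.1 i j
  · rw [star_trivial, dotProduct_gradPsi_mulVec]
    exact dirPsi_nonneg hk hkd hV (by simpa using Matrix.posSemidef_vecMulVec_self_star u)

lemma posSemidef_Mstar {k : ℕ} (hk : 1 ≤ k) (hkd : k ≤ d) {V : Matrix (Fin d) (Fin d) ℝ}
    (hV : V.PosSemidef) : (Mstar k V).PosSemidef :=
  (posSemidef_gradPsi hk hkd hV).smul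
    (inv_nonneg.mpr (mul_nonneg k.cast_nonneg (Psi_nonneg hV k)))

lemma trace_Mstar_mul (k : ℕ) (V : Matrix (Fin d) (Fin d) ℝ) {W : Matrix (Fin d) (Fin d) ℝ}
    (hW : W.IsHermitian) : (Mstar k V * W).trace = (k * Psi k V)⁻¹ * dirPsi k V W := by
  rw [Mstar, smul_mul_assoc, trace_smul, smul_eq_mul]
  congr 1
  simp only [trace, diag_apply, Matrix.mul_apply, dirPsi]
  exact Finset.sum_congr rfl fun i _ => Finset.sum_congr rfl fun j _ => by
    rw [show W j i = W i j by simpa using hW.apply i j]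

/-- `V` attains the polar function at `M_*(V)`. -/
lemma attainsPolar_Mstar {k : ℕ} (hk : 1 ≤ k) (hkd : k ≤ d) {V : Matrix (Fin d) (Fin d) ℝ}
    (hV : V.PosSemidef) (hpos : 0 < Psi k V) : AttainsPolar k (Mstar k V) V := by
  have hk0 : (0 : ℝ) < k := by exact_mod_cast hk
  refine ⟨hV, ?_, fun W hW hMW => ?_⟩
  · rw [trace_Mstar_mul k V hV.1, dirPsi_self, inv_mul_cancel₀ (by positivity)]
  · rw [trace_Mstar_mul k V hW.1, inv_mul_eq_one₀ (by positivity)] at hMW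
    have h1 := le_dirPsi hk hkd hV hW
    have hr := rootPsi_pos hpos
    rw [← hMW, ← rootPsi_pow hV hk] at h1
    refine Psi_le_Psi_of_rootPsi_le hW hV hk ?_
    obtain ⟨m, rfl⟩ : ∃ m, k = m + 1 := ⟨k - 1, by omega⟩
    rw [Nat.add_sub_cancel, pow_succ, ← mul_assoc] at h1
    exact le_of_mul_le_mul_left h1 (by positivity)

end Gradient

end GenVar

namespace GenVar

open Matrix

/-! ### Moments, mixtures, existence and contact points -/

section Measures

variable {d : ℕ} {X : Set (Fin d → ℝ)} {μ : Measure (Fin d → ℝ)}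

lemma ae_mem_of_mem_probMeasures (hμ : μ ∈ probMeasures X) : ∀ᵐ x ∂μ, x ∈ X :=
  mem_ae_iff.mpr hμ.2

lemma integrable_of_mem_probMeasures (hX : IsCompact X) (hμ : μ ∈ probMeasures X)
    {f : (Fin d → ℝ) → ℝ} (hf : Continuous f) : Integrable f μ := by
  have := hμ.1
  have h : IntegrableOn f X μ := hf.continuousOn.integrableOn_compact hX
  rwa [IntegrableOn, Measure.restrict_eq_self_of_ae_mem (ae_mem_of_mem_probMeasures hμ)] at h

lemma integral_sub_mul_sub_eq (hX : IsCompact X) (hμ : μ ∈ probMeasures X) (i j : Fin d)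
    (a b : ℝ) : ∫ x, (x i - a) * (x j - b) ∂μ =
      ∫ x, x i * x j ∂μ - b * mean μ i - a * mean μ j + a * b := by
  have := hμ.1
  have hint : ∀ {f : (Fin d → ℝ) → ℝ}, Continuous f → Integrable f μ :=
    fun hf => integrable_of_mem_probMeasures hX hμ hf
  have h : ∀ x : Fin d → ℝ, (x i - a) * (x j - b) = x i * x j - b * x i - a * x j + a * b :=
    fun x => by ring
  simp_rw [h]
  rw [integral_add (hint (by fun_prop)) (hint (by fun_prop)),
    integral_sub (hint (by fun_prop)) (hint (by fun_prop)),
    integral_sub (hint (by fun_prop)) (hint (by fun_prop)),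
    integral_const_mul, integral_const_mul]
  simp [mean]

lemma covMat_apply_eq (hX : IsCompact X) (hμ : μ ∈ probMeasures X) (i j : Fin d) :
    covMat μ i j = ∫ x, x i * x j ∂μ - mean μ i * mean μ j := by
  have h : covMat μ i j = ∫ x, (x i - mean μ i) * (x j - mean μ j) ∂μ := rfl
  rw [h, integral_sub_mul_sub_eq hX hμ]
  ring

lemma integral_sub_mul_sub (hX : IsCompact X) (hμ : μ ∈ probMeasures X) (i j : Fin d)
    (a b : ℝ) : ∫ x, (x i - a) * (x j - b) ∂μ =
      covMat μ i j + (mean μ i - a) * (mean μ j - b) := by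
  rw [integral_sub_mul_sub_eq hX hμ, covMat_apply_eq hX hμ]
  ring

/-- The quadratic form that defines the ellipsoid `E(M, c)`. -/
def ellipsoidForm (M : Matrix (Fin d) (Fin d) ℝ) (c x : Fin d → ℝ) : ℝ :=
  (x - c) ⬝ᵥ M *ᵥ (x - c)

lemma continuous_ellipsoidForm (M : Matrix (Fin d) (Fin d) ℝ) (c : Fin d → ℝ) :
    Continuous (ellipsoidForm M c) := by
  unfold ellipsoidForm dotProduct mulVec dotProduct
  fun_prop

lemma ellipsoidForm_nonneg {M : Matrix (Fin d) (Fin d) ℝ} (hM : M.PosSemidef)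
    (c x : Fin d → ℝ) : 0 ≤ ellipsoidForm M c x := by
  have h := hM.dotProduct_mulVec_nonneg (x - c)
  rwa [star_trivial] at h

lemma covMat_isHermitian (μ : Measure (Fin d → ℝ)) : (covMat μ).IsHermitian := by
  ext i j
  simp [covMat, covariance_comm (fun x : Fin d → ℝ => x j)]

/-- The second moment about `c` is the covariance plus the squared bias; the cross terms integrate
to zero. -/
lemma integral_ellipsoidForm (hX : IsCompact X) (hμ : μ ∈ probMeasures X)
    (M : Matrix (Fin d) (Fin d) ℝ) (c : Fin d → ℝ) :
    ∫ x, ellipsoidForm M c x ∂μ = (M * covMat μ).trace + ellipsoidForm M c (mean μ) := by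
  have hint : ∀ {f : (Fin d → ℝ) → ℝ}, Continuous f → Integrable f μ :=
    fun hf => integrable_of_mem_probMeasures hX hμ hf
  have hform : ∀ x, ellipsoidForm M c x = ∑ i, ∑ j, M i j * ((x i - c i) * (x j - c j)) := by
    intro x
    simp only [ellipsoidForm, dotProduct, mulVec, Finset.mul_sum, Pi.sub_apply]
    exact Finset.sum_congr rfl fun i _ => Finset.sum_congr rfl fun j _ => by ring
  simp_rw [hform]
  rw [integral_finsetSum _ fun i _ => hint (by fun_prop)]
  simp only [trace, diag_apply, Matrix.mul_apply]
  rw [← Finset.sum_add_distrib]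
  refine Finset.sum_congr rfl fun i _ => ?_
  rw [integral_finsetSum _ fun j _ => hint (by fun_prop), ← Finset.sum_add_distrib]
  refine Finset.sum_congr rfl fun j _ => ?_
  rw [integral_const_mul, integral_sub_mul_sub hX hμ, mul_add,
    show covMat μ i j = covMat μ j i by simpa using (covMat_isHermitian μ).apply j i]

lemma posSemidef_covMat (hX : IsCompact X) (hμ : μ ∈ probMeasures X) :
    (covMat μ).PosSemidef := by
  refine Matrix.PosSemidef.of_dotProduct_mulVec_nonneg (covMat_isHermitian μ) fun u => ?_
  have hu : (vecMulVec u u).PosSemidef := by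
    simpa using Matrix.posSemidef_vecMulVec_self_star u
  -- With `M = uuᵀ` and `c = E_μ` this writes `uᵀ V_μ u` as the integral of a nonnegative form.
  have h := integral_ellipsoidForm hX hμ (vecMulVec u u) (mean μ)
  have h0 : ellipsoidForm (vecMulVec u u) (mean μ) (mean μ) = 0 := by simp [ellipsoidForm]
  rw [h0, add_zero, trace_mul_comm, mul_vecMulVec, trace_vecMulVec, dotProduct_comm] at h
  rw [star_trivial, ← h]
  exact integral_nonneg fun x => ellipsoidForm_nonneg hu _ x

lemma trace_mul_covMat_add_le (hX : IsCompact X) (hμ : μ ∈ probMeasures X)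
    {M : Matrix (Fin d) (Fin d) ℝ} {c : Fin d → ℝ} (h : Encloses X M c) :
    (M * covMat μ).trace + ellipsoidForm M c (mean μ) ≤ 1 := by
  have := hμ.1
  rw [← integral_ellipsoidForm hX hμ]
  calc ∫ x, ellipsoidForm M c x ∂μ ≤ ∫ _x, (1 : ℝ) ∂μ := by
        refine integral_mono_ae
          (integrable_of_mem_probMeasures hX hμ (continuous_ellipsoidForm M c))
          (integrable_const _) ?_
        filter_upwards [ae_mem_of_mem_probMeasures hμ] with x hx using h.2 hx
    _ = 1 := by simp

lemma trace_mul_covMat_le_one (hX : IsCompact X) (hμ : μ ∈ probMeasures X)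
    {M : Matrix (Fin d) (Fin d) ℝ} {c : Fin d → ℝ} (h : Encloses X M c) :
    (M * covMat μ).trace ≤ 1 := by
  linarith [trace_mul_covMat_add_le hX hμ h, ellipsoidForm_nonneg h.1 c (mean μ)]

lemma rootPsi_covMat_mul_polar_le_one {k : ℕ} (hk : 1 ≤ k) (hkd : k ≤ d) (hX : IsCompact X)
    (hμ : μ ∈ probMeasures X) {M : Matrix (Fin d) (Fin d) ℝ} {c : Fin d → ℝ}
    (h : Encloses X M c) : rootPsi k (covMat μ) * polar k M ≤ 1 := by
  rw [mul_comm]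
  exact (polar_mul_rootPsi_le hk hkd h.1 (posSemidef_covMat hX hμ)).trans
    (trace_mul_covMat_le_one hX hμ h)

/-- The mixture `(1 - t) μ + t δ_x`. -/
noncomputable def mixDirac (μ : Measure (Fin d → ℝ)) (x : Fin d → ℝ) (t : ℝ) :
    Measure (Fin d → ℝ) :=
  ENNReal.ofReal (1 - t) • μ + ENNReal.ofReal t • Measure.dirac x

lemma mixDirac_mem_probMeasures (hX : IsCompact X) (hμ : μ ∈ probMeasures X) {x : Fin d → ℝ}
    (hx : x ∈ X) {t : ℝ} (ht : 0 ≤ t) (ht1 : t ≤ 1) : mixDirac μ x t ∈ probMeasures X := by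
  have := hμ.1
  refine ⟨⟨?_⟩, ?_⟩
  · simp [mixDirac, ← ENNReal.ofReal_add (sub_nonneg.mpr ht1) ht]
  · simp [mixDirac, hμ.2, Measure.dirac_apply' x hX.measurableSet.compl, hx]

lemma integral_mixDirac (hX : IsCompact X) (hμ : μ ∈ probMeasures X) {x : Fin d → ℝ}
    {t : ℝ} (ht : 0 ≤ t) (ht1 : t ≤ 1) {f : (Fin d → ℝ) → ℝ} (hf : Continuous f) :
    ∫ y, f y ∂(mixDirac μ x t) = (1 - t) * ∫ y, f y ∂μ + t * f x := by
  rw [mixDirac, integral_add_measure, integral_smul_measure, integral_smul_measure,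
    integral_dirac, ENNReal.toReal_ofReal (sub_nonneg.mpr ht1), ENNReal.toReal_ofReal ht,
    smul_eq_mul, smul_eq_mul]
  · exact (integrable_of_mem_probMeasures hX hμ hf).smul_measure ENNReal.ofReal_ne_top
  · exact (integrable_dirac (by simp)).smul_measure ENNReal.ofReal_ne_top

/-- Pulling out `1 - t` leaves a straight line of matrices, so homogeneity of `Ψ_k` reduces the
derivative along mixtures to `dirPsi`. -/
lemma covMat_mixDirac (hX : IsCompact X) (hμ : μ ∈ probMeasures X) {x : Fin d → ℝ}
    (hx : x ∈ X) {t : ℝ} (ht : 0 ≤ t) (ht1 : t ≤ 1) :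
    covMat (mixDirac μ x t) =
      (1 - t) • (covMat μ + t • vecMulVec (x - mean μ) (x - mean μ)) := by
  ext i j
  have hm : ∀ i, mean (mixDirac μ x t) i = (1 - t) * mean μ i + t * x i := fun i =>
    integral_mixDirac hX hμ ht ht1 (continuous_apply i)
  rw [covMat_apply_eq hX (mixDirac_mem_probMeasures hX hμ hx ht ht1), hm, hm,
    integral_mixDirac hX hμ ht ht1 (by fun_prop)]
  simp only [Matrix.smul_apply, Matrix.add_apply, vecMulVec_apply, Pi.sub_apply, smul_eq_mul]
  rw [covMat_apply_eq hX hμ]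
  ring

/-- The first order optimality condition. -/
lemma IsOptimalMeasure.dirPsi_le {k : ℕ} (hX : IsCompact X) (h : IsOptimalMeasure k X μ)
    {x : Fin d → ℝ} (hx : x ∈ X) :
    dirPsi k (covMat μ) (vecMulVec (x - mean μ) (x - mean μ)) ≤ k * Psi k (covMat μ) := by
  set W := vecMulVec (x - mean μ) (x - mean μ)
  have h1 : HasDerivAt (fun t : ℝ => (1 - t) ^ k * Psi k (covMat μ + t • W))
      (-(k * Psi k (covMat μ)) + dirPsi k (covMat μ) W) 0 := by
    simpa using (((hasDerivAt_id (0 : ℝ)).const_sub 1).fun_pow k).fun_mul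
      (hasDerivAt_Psi k (covMat μ) W)
  have h2 := le_of_hasDerivAt_of_le h1 (hasDerivAt_const 0 (Psi k (covMat μ))) (by simp)
    fun t ht ht1 => by
      rw [← Psi_smul, ← covMat_mixDirac hX h.1 hx ht.le ht1.le]
      exact h.2 _ (mixDirac_mem_probMeasures hX h.1 hx ht.le ht1.le)
  linarith

lemma IsOptimalMeasure.encloses_Mstar {k : ℕ} (hk : 1 ≤ k) (hkd : k ≤ d) (hX : IsCompact X)
    (h : IsOptimalMeasure k X μ) (hpos : 0 < Psi k (covMat μ)) :
    Encloses X (Mstar k (covMat μ)) (mean μ) := by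
  refine ⟨posSemidef_Mstar hk hkd (posSemidef_covMat hX h.1), fun x hx => ?_⟩
  have hk0 : (0 : ℝ) < k := by exact_mod_cast hk
  change (x - mean μ) ⬝ᵥ Mstar k (covMat μ) *ᵥ (x - mean μ) ≤ 1
  rw [Mstar, smul_mulVec, dotProduct_smul, dotProduct_gradPsi_mulVec, smul_eq_mul,
    inv_mul_le_one₀ (mul_pos hk0 hpos)]
  exact h.dirPsi_le hX hx

/-- Probability measures on a compact space form a weakly compact space, on which the covariance,
written as `S` through moments of continuous functions, is continuous. `hlift` and `hpush` carry
measures between `ℝ^d` and the subtype `X`. -/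
lemma exists_isOptimalMeasure (k : ℕ) (hX : IsCompact X) (hne : (probMeasures X).Nonempty) :
    ∃ μ, IsOptimalMeasure k X μ := by
  have : CompactSpace X := isCompact_iff_compactSpace.mp hX
  have hmeas := hX.measurableSet
  let S : ProbabilityMeasure X → Matrix (Fin d) (Fin d) ℝ := fun P => Matrix.of fun i j =>
    ∫ x : X, (x : Fin d → ℝ) i * (x : Fin d → ℝ) j ∂(P : Measure X) -
      (∫ x : X, (x : Fin d → ℝ) i ∂(P : Measure X)) *
        ∫ x : X, (x : Fin d → ℝ) j ∂(P : Measure X)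
  have hcont_int : ∀ f : X → ℝ, Continuous f →
      Continuous fun P : ProbabilityMeasure X => ∫ x, f x ∂(P : Measure X) := by
    intro f hf
    exact ProbabilityMeasure.continuous_integral_boundedContinuousFunction
      (BoundedContinuousFunction.mkOfCompact ⟨f, hf⟩)
  have hS : Continuous S := by
    refine continuous_matrix fun i j => ?_
    have hc : ∀ i, Continuous fun x : X => (x : Fin d → ℝ) i := fun i =>
      (continuous_apply i).comp continuous_subtype_val
    exact (hcont_int _ ((hc i).mul (hc j))).sub ((hcont_int _ (hc i)).mul (hcont_int _ (hc j)))
  have hlift : ∀ μ ∈ probMeasures X, ∃ P : ProbabilityMeasure X, S P = covMat μ := by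
    intro μ hμ
    have := hμ.1
    have hae := ae_mem_of_mem_probMeasures hμ
    have hint : ∀ f : (Fin d → ℝ) → ℝ,
        ∫ x : X, f x ∂(μ.comap Subtype.val) = ∫ x, f x ∂μ := fun f => by
      rw [integral_subtype_comap hmeas f, Measure.restrict_eq_self_of_ae_mem hae]
    have hP : IsProbabilityMeasure (μ.comap (Subtype.val : X → Fin d → ℝ)) := by
      refine ⟨?_⟩
      rw [comap_subtype_coe_apply hmeas, Set.image_univ, Subtype.range_coe]
      exact (prob_compl_eq_zero_iff hmeas).mp hμ.2
    refine ⟨⟨_, hP⟩, ?_⟩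
    ext i j
    rw [covMat_apply_eq hX hμ]
    simp only [S, of_apply, ProbabilityMeasure.coe_mk, mean]
    rw [hint fun x => x i * x j, hint fun x => x i, hint fun x => x j]
  have hpush : ∀ P : ProbabilityMeasure X, ∃ μ ∈ probMeasures X, covMat μ = S P := by
    intro P
    have hval : Measurable (Subtype.val : X → Fin d → ℝ) := measurable_subtype_coe
    have hmem : (P : Measure X).map Subtype.val ∈ probMeasures X := by
      refine ⟨Measure.isProbabilityMeasure_map hval.aemeasurable, ?_⟩
      rw [Measure.map_apply hval hmeas.compl]
      simp
    refine ⟨_, hmem, ?_⟩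
    have hint : ∀ f : (Fin d → ℝ) → ℝ, Continuous f →
        ∫ x, f x ∂((P : Measure X).map Subtype.val) = ∫ x : X, f x ∂(P : Measure X) :=
      fun f hf => integral_map hval.aemeasurable hf.aestronglyMeasurable
    ext i j
    rw [covMat_apply_eq hX hmem]
    simp only [S, of_apply, mean]
    rw [hint (fun x => x i * x j) (by fun_prop), hint (fun x => x i) (by fun_prop),
      hint (fun x => x j) (by fun_prop)]
  obtain ⟨μ₀, hμ₀⟩ := hne
  obtain ⟨P₀, -⟩ := hlift μ₀ hμ₀
  obtain ⟨P, -, hP⟩ := isCompact_univ.exists_isMaxOn ⟨P₀, Set.mem_univ P₀⟩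
    ((continuous_Psi k).comp hS).continuousOn
  obtain ⟨μ, hμ, hμP⟩ := hpush P
  refine ⟨μ, hμ, fun ν hν => ?_⟩
  obtain ⟨Q, hQ⟩ := hlift ν hν
  rw [hμP, ← hQ]
  exact hP (Set.mem_univ Q)

lemma mem_frontier_ellipsoid {M : Matrix (Fin d) (Fin d) ℝ} {c x : Fin d → ℝ}
    (h : ellipsoidForm M c x = 1) : x ∈ frontier (ellipsoid M c) := by
  refine ⟨subset_closure h.le, fun hint => ?_⟩
  -- Pushing `x` away from `c` by a factor `t > 1` multiplies the form by `t²`, so points outside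
  -- the ellipsoid come arbitrarily close to `x`.
  have hc : Continuous fun t : ℝ => c + t • (x - c) := by fun_prop
  have h1 : Filter.Tendsto (fun t : ℝ => c + t • (x - c)) (nhdsWithin 1 (Set.Ioi 1)) (nhds x) := by
    simpa using (hc.tendsto 1).mono_left nhdsWithin_le_nhds
  obtain ⟨t, ht, ht1⟩ := ((h1.eventually (mem_interior_iff_mem_nhds.mp hint)).and
    self_mem_nhdsWithin).exists
  have h2 : ellipsoidForm M c (c + t • (x - c)) = t * t := by
    rw [← mul_one (t * t), ← h]
    simp only [ellipsoidForm, add_sub_cancel_left, mulVec_smul, dotProduct_smul, smul_dotProduct,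
      smul_eq_mul, mul_assoc]
  have h3 : ellipsoidForm M c (c + t • (x - c)) ≤ 1 := ht
  have h4 : (1 : ℝ) < t := ht1
  nlinarith

/-- Trace one forces the nonnegative function `1 - ellipsoidForm M c` to have integral zero, hence
to vanish almost everywhere; its zero set in `X` is closed and so contains the support. -/
lemma support_subset_contactPoints (hX : IsCompact X) (hμ : μ ∈ probMeasures X)
    {M : Matrix (Fin d) (Fin d) ℝ} {c : Fin d → ℝ} (h : Encloses X M c)
    (htr : (M * covMat μ).trace = 1) : μ.support ⊆ contactPoints X M c := by
  have := hμ.1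
  have hcont := continuous_ellipsoidForm M c
  have hint := integrable_of_mem_probMeasures hX hμ hcont
  have hle := trace_mul_covMat_add_le hX hμ h
  have hnn := ellipsoidForm_nonneg h.1 c (mean μ)
  have hzero : ∫ x, (1 - ellipsoidForm M c x) ∂μ = 0 := by
    rw [integral_sub (integrable_const _) hint, integral_ellipsoidForm hX hμ, htr]
    simp
    linarith
  have hae := (integral_eq_zero_iff_of_nonneg_ae (by
    filter_upwards [ae_mem_of_mem_probMeasures hμ] with x hx using sub_nonneg.mpr (h.2 hx))
    ((integrable_const _).sub hint)).mp hzero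
  have hclosed : IsClosed (X ∩ {x | ellipsoidForm M c x = 1}) :=
    hX.isClosed.inter (isClosed_eq hcont continuous_const)
  refine (Measure.support_subset_of_isClosed hclosed ?_).trans
    fun x hx => ⟨hx.1, mem_frontier_ellipsoid hx.2⟩
  filter_upwards [ae_mem_of_mem_probMeasures hμ, hae] with x hx h1
  exact ⟨hx, (sub_eq_zero.mp h1).symm⟩

end Measures

end GenVar

/-! ### Closing the duality gap -/

theorem mainTheorem5 (d k : ℕ) (hk : 1 ≤ k) (hkd : k ≤ d)
    (X : Set (Fin d → ℝ)) (hX : IsCompact X)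
    (hpos : ∃ μ ∈ GenVar.probMeasures X, 0 < GenVar.Psi k (GenVar.covMat μ)) :
    -- both problems have a solution
    (∃ μ, GenVar.IsOptimalMeasure k X μ) ∧
    (∃ M c, GenVar.IsOptimalEllipsoid k X M c) ∧
    -- the two problems are equivalent
    (∀ μ ∈ GenVar.probMeasures X, ∀ M c, GenVar.Encloses X M c →
      List.TFAE [
        GenVar.IsOptimalMeasure k X μ ∧ GenVar.IsOptimalEllipsoid k X M c,
        GenVar.Psi k (GenVar.covMat μ) ^ ((1 : ℝ) / k) * GenVar.polar k M = 1,
        GenVar.AttainsPolar k M (GenVar.covMat μ)]) ∧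
    -- an optimal covariance matrix gives an optimal ellipsoid
    (∀ μ, GenVar.IsOptimalMeasure k X μ →
      GenVar.IsOptimalEllipsoid k X (GenVar.Mstar k (GenVar.covMat μ)) (GenVar.mean μ)) ∧
    -- every optimal ellipsoid is centred at the optimal mean, and the support of every optimal
    -- measure consists of points of contact
    (∀ μ M c, GenVar.IsOptimalMeasure k X μ → GenVar.IsOptimalEllipsoid k X M c →
      M.PosDef ∧ c = GenVar.mean μ ∧ μ.support ⊆ GenVar.contactPoints X M c) := by
  open GenVar in
  have hoptpos : ∀ μ, IsOptimalMeasure k X μ → 0 < Psi k (covMat μ) := fun μ hμ => by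
    obtain ⟨ν, hν, hνpos⟩ := hpos
    exact hνpos.trans_le (hμ.2 ν hν)
  have hMprod : ∀ μ, IsOptimalMeasure k X μ →
      rootPsi k (covMat μ) * polar k (Mstar k (covMat μ)) = 1 := fun μ hμ =>
    (attainsPolar_Mstar hk hkd (posSemidef_covMat hX hμ.1) (hoptpos μ hμ)).rootPsi_mul_polar hkd
      (posSemidef_Mstar hk hkd (posSemidef_covMat hX hμ.1))
  have h21 : ∀ μ ∈ probMeasures X, ∀ M c, Encloses X M c →
      rootPsi k (covMat μ) * polar k M = 1 →
      IsOptimalMeasure k X μ ∧ IsOptimalEllipsoid k X M c := by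
    intro μ hμ M c hM h
    have hV := posSemidef_covMat hX hμ
    have hr : 0 < rootPsi k (covMat μ) :=
      (rootPsi_nonneg hV k).lt_of_ne fun h0 => by simp [← h0] at h
    have hp : 0 < polar k M :=
      (polar_nonneg k M).lt_of_ne fun h0 => by simp [← h0] at h
    refine ⟨⟨hμ, fun ν hν => ?_⟩, hM, fun M' c' hM' => ?_⟩
    · refine Psi_le_Psi_of_rootPsi_le (posSemidef_covMat hX hν) hV hk ?_
      refine le_of_mul_le_mul_right ?_ hp
      rw [h]
      exact rootPsi_covMat_mul_polar_le_one hk hkd hX hν hM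
    · refine le_of_mul_le_mul_left ?_ hr
      rw [h]
      exact rootPsi_covMat_mul_polar_le_one hk hkd hX hμ hM'
  have h12 : ∀ μ M c, IsOptimalMeasure k X μ → IsOptimalEllipsoid k X M c →
      rootPsi k (covMat μ) * polar k M = 1 := by
    intro μ M c hμ hM
    refine le_antisymm (rootPsi_covMat_mul_polar_le_one hk hkd hX hμ.1 hM.1) ?_
    -- `M_*(V_μ)` is feasible and already gives product 1, so an optimal `M` does at least as well.
    rw [← hMprod μ hμ]
    exact mul_le_mul_of_nonneg_left
      (hM.2 _ _ (hμ.encloses_Mstar hk hkd hX (hoptpos μ hμ)))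
      (rootPsi_nonneg (posSemidef_covMat hX hμ.1) k)
  have h23 : ∀ μ ∈ probMeasures X, ∀ M c, Encloses X M c →
      rootPsi k (covMat μ) * polar k M = 1 → AttainsPolar k M (covMat μ) := by
    intro μ hμ M c hM h
    have hV := posSemidef_covMat hX hμ
    have htr : (M * covMat μ).trace = 1 := by
      refine le_antisymm (trace_mul_covMat_le_one hX hμ hM) ?_
      rw [← h, mul_comm]
      exact polar_mul_rootPsi_le hk hkd hM.1 hV
    have hp : 0 < polar k M :=
      (polar_nonneg k M).lt_of_ne fun h0 => by simp [← h0] at h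
    refine ⟨hV, htr, fun W hW hMW => ?_⟩
    refine Psi_le_Psi_of_rootPsi_le hW hV hk (le_of_mul_le_mul_left ?_ hp)
    rw [mul_comm _ (rootPsi k (covMat μ)), h, ← hMW]
    exact polar_mul_rootPsi_le hk hkd hM.1 hW
  have hstar : ∀ μ, IsOptimalMeasure k X μ →
      IsOptimalEllipsoid k X (Mstar k (covMat μ)) (mean μ) := fun μ hμ =>
    (h21 μ hμ.1 _ _ (hμ.encloses_Mstar hk hkd hX (hoptpos μ hμ)) (hMprod μ hμ)).2
  obtain ⟨μ₀, hμ₀⟩ := exists_isOptimalMeasure k hX ⟨hpos.choose, hpos.choose_spec.1⟩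
  refine ⟨⟨μ₀, hμ₀⟩, ⟨_, _, hstar μ₀ hμ₀⟩, fun μ hμ M c hM => ?_, hstar, fun μ M c hμ hM => ?_⟩
  · tfae_have 1 → 2 := fun h => h12 μ M c h.1 h.2
    tfae_have 2 → 1 := h21 μ hμ M c hM
    tfae_have 2 → 3 := h23 μ hμ M c hM
    tfae_have 3 → 2 := fun h => h.rootPsi_mul_polar hkd hM.1
    tfae_finish
  · have h := h12 μ M c hμ hM
    have htr := (h23 μ hμ.1 M c hM.1 h).2.1
    have hp : 0 < polar k M :=
      (polar_nonneg k M).lt_of_ne fun h0 => by simp [← h0] at h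
    have hPD := posDef_of_polar_pos hk hkd hM.1.1 hp
    refine ⟨hPD, ?_, support_subset_contactPoints hX hμ.1 hM.1 htr⟩
    -- Trace one leaves no room for the bias term, which is positive when `c ≠ E_μ` because `M` is
    -- positive definite.
    by_contra hne
    have h1 := hPD.dotProduct_mulVec_pos (sub_ne_zero.mpr (Ne.symm hne))
    have h2 := trace_mul_covMat_add_le hX hμ.1 hM.1
    rw [htr] at h2
    simp only [star_trivial] at h1
    change 1 + (mean μ - c) ⬝ᵥ M.mulVec (mean μ - c) ≤ 1 at h2
    linarith
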